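/- Let $L,\beta,\alpha>0$ and $\gamma\ge 0$. Equip $H_0^1=H_0^1(0,L)$ with the norm $\|u\|_{H^1}=\big(\int_0^L u^2\,d\xi+\frac{\beta}{6}\int_0^L (u')^2\,d\xi\big)^{1/2}$ and $H_0^1\times H_0^1$ with $\|(u,v)\|_{H^1\times H^1}=\big(\|u\|_{H^1}^2+\|v\|_{H^1}^2\big)^{1/2}$. Fix initial data $(N_0,V_0)\in H_0^1\times H_0^1$. For $T>0$ and $c\in L^2(0,L)$, let $(N(\cdot,t;c),V(\cdot,t;c))$, $0\le t\le T$, be the solution of $$N_t+V_\xi-\tfrac{\beta}{6}N_{\xi\xi t}=0,\qquad V_t+(c\,N)_\xi-\tfrac{\beta}{6}V_{\xi\xi t}=0\qquad\text{on }(0,L)\times[0,T],$$ with $N(\cdot,0)=N_0$, $V(\cdot,0)=V_0$ and homogeneous Dirichlet boundary conditions; that is, $N,V:[0,T]\to H_0^1$ are differentiable in time with values in $H_0^1$ and, for all $t\in[0,T]$ and $\phi,\psi\in H_0^1$, $$\int_0^L N_t\phi\,d\xi-\int_0^L V\phi_\xi\,d\xi+\frac{\beta}{6}\int_0^L N_{\xi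 t}\phi_\xi\,d\xi=0,\qquad \int_0^L V_t\psi\,d\xi-\int_0^L cN\psi_\xi\,d\xi+\frac{\beta}{6}\int_0^L V_{\xi t}\psi_\xi\,d\xi=0 .$$ Let $\mathcal M_\gamma=\{c\in L^2(0,L):\|c\|_{L^2}\le\gamma\}$. For a measurement $m=(m_1,m_2)\in H_0^1\times H_0^1$, an optimal solution of the restricted minimization problem at final time $T$ is a minimizer over $\mathcal M_\gamma$ of the Tikhonov functional $$J_\alpha(c)=\tfrac12\|N(\cdot,T;c)-m_1\|_{H^1}^2+\tfrac12\|V(\cdot,T;c)-m_2\|_{H^1}^2+\tfrac{\alpha}{2}\|c\|_{L^2}^2 .$$ Theorem (local stability of the restricted minimization problem). For every $\rho$ there are $T_0>0$ and $\mathcal S>0$, depending only on $L,\beta,\alpha,\gamma,(N_0,V_0)$ and $\rho$, such that for every $T\in(0,T_0]$, all measurements $m,\tilde m\in H_0^1\times H_0^1$ with $\|m\|_{H^1\times H^1}\le\rho$ and $\|\tilde m\|_{H^1\times H^1}\le\rho$, and all optimal solutions $c,\tilde c\in\mathcal M_\gamma$ of the restricted minimization problem at final time $T$ for $m$ and $\tilde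 m$ respectively, $$\|\tilde c-c\|_{L^2}\le \mathcal S\,\|\tilde m-m\|_{H^1\times H^1}.$$ In particular, for any two given measurements such $T_0$ and $\mathcal S$ exist. -/

import Mathlib

open MeasureTheory

namespace BoussinesqRMP

noncomputable section

/-- Lebesgue measure on the interval `(0, L)`. -/
abbrev vol (L : ℝ) : Measure ℝ := volume.restrict (Set.Ioo 0 L)

/-- The real Hilbert space `L²(0, L)`. -/
abbrev L2 (L : ℝ) : Type := Lp ℝ 2 (vol L)

/-- `g ∈ L²(0, L)` is the weak derivative of `u ∈ L²(0, L)`: integration by parts holds against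
every smooth function with compact support in `(0, L)`. -/
def HasWeakDeriv (L : ℝ) (u g : L2 L) : Prop :=
  ∀ φ : ℝ → ℝ, ContDiff ℝ (⊤ : ℕ∞) φ → HasCompactSupport φ → tsupport φ ⊆ Set.Ioo 0 L →
    ∫ x, u x * deriv φ x ∂(vol L) = -∫ x, g x * φ x ∂(vol L)

/-- `u` has a representative that is continuous on `[0, L]` and vanishes at `0` and at `L`. -/
def VanishesAtEnds (L : ℝ) (u : L2 L) : Prop :=
  ∃ v : ℝ → ℝ, ContinuousOn v (Set.Icc 0 L) ∧ u =ᵐ[vol L] v ∧ v 0 = 0 ∧ v L = 0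

theorem integrable_mul_test {L : ℝ} (u : L2 L) {φ : ℝ → ℝ} (hφ : Continuous φ)
    (hc : HasCompactSupport φ) : Integrable (fun x => u x * φ x) (vol L) := by
  have h : MemLp φ 2 (vol L) := (hφ.memLp_of_hasCompactSupport hc).restrict _
  exact (Lp.memLp u).integrable_mul h

theorem HasWeakDeriv.add {L : ℝ} {u g u' g' : L2 L} (h : HasWeakDeriv L u g)
    (h' : HasWeakDeriv L u' g') : HasWeakDeriv L (u + u') (g + g') := by
  intro φ hφ hc hs
  have hd : Continuous (deriv φ) := hφ.continuous_deriv (by exact_mod_cast le_top)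
  have e1 : ∫ x, (u + u' : L2 L) x * deriv φ x ∂(vol L)
      = ∫ x, (u x * deriv φ x + u' x * deriv φ x) ∂(vol L) := by
    refine integral_congr_ae ?_
    filter_upwards [Lp.coeFn_add u u'] with x hx
    rw [hx, Pi.add_apply, add_mul]
  have e2 : ∫ x, (g + g' : L2 L) x * φ x ∂(vol L)
      = ∫ x, (g x * φ x + g' x * φ x) ∂(vol L) := by
    refine integral_congr_ae ?_
    filter_upwards [Lp.coeFn_add g g'] with x hx
    rw [hx, Pi.add_apply, add_mul]
  rw [e1, e2, integral_add (integrable_mul_test u hd hc.deriv) (integrable_mul_test u' hd hc.deriv),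
    integral_add (integrable_mul_test g hφ.continuous hc) (integrable_mul_test g' hφ.continuous hc),
    h φ hφ hc hs, h' φ hφ hc hs, neg_add]

theorem HasWeakDeriv.smul {L : ℝ} {u g : L2 L} (a : ℝ) (h : HasWeakDeriv L u g) :
    HasWeakDeriv L (a • u) (a • g) := by
  intro φ hφ hc hs
  have e1 : ∫ x, (a • u : L2 L) x * deriv φ x ∂(vol L)
      = ∫ x, a * (u x * deriv φ x) ∂(vol L) := by
    refine integral_congr_ae ?_
    filter_upwards [Lp.coeFn_smul a u] with x hx
    rw [hx, Pi.smul_apply, smul_eq_mul, mul_assoc]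
  have e2 : ∫ x, (a • g : L2 L) x * φ x ∂(vol L) = ∫ x, a * (g x * φ x) ∂(vol L) := by
    refine integral_congr_ae ?_
    filter_upwards [Lp.coeFn_smul a g] with x hx
    rw [hx, Pi.smul_apply, smul_eq_mul, mul_assoc]
  rw [e1, e2, integral_const_mul, integral_const_mul, h φ hφ hc hs, mul_neg]

theorem hasWeakDeriv_zero (L : ℝ) : HasWeakDeriv L 0 0 := by
  have h0 : ∀ᵐ x ∂(vol L), (0 : L2 L) x = 0 := by
    filter_upwards [Lp.coeFn_zero ℝ 2 (vol L)] with x hx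
    simpa using hx
  intro φ _ _ _
  have e (f : ℝ → ℝ) : ∫ x, (0 : L2 L) x * f x ∂(vol L) = 0 := by
    refine integral_eq_zero_of_ae ?_
    filter_upwards [h0] with x hx
    rw [hx, zero_mul, Pi.zero_apply]
  rw [e, e, neg_zero]

/-- The Sobolev space `H¹₀(0, L)`: the pairs `(u, u')` in `L²(0, L) × L²(0, L)` in which `u'` is
the weak derivative of `u` and `u(0) = u(L) = 0`. As a topological vector space it carries the
usual structure, induced by `(‖u‖² + ‖u'‖²)^(1/2)`; the weighted norm is `normH1` below. -/
def H10 (L : ℝ) : Submodule ℝ (WithLp 2 (L2 L × L2 L)) where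
  carrier := {w | HasWeakDeriv L w.fst w.snd ∧ VanishesAtEnds L w.fst}
  add_mem' := by
    rintro a b ⟨ha, v, hv, hav, hv0, hvL⟩ ⟨hb, w, hw, hbw, hw0, hwL⟩
    refine ⟨ha.add hb, v + w, hv.add hw, ?_, by simp [hv0, hw0], by simp [hvL, hwL]⟩
    exact (Lp.coeFn_add a.fst b.fst).trans (hav.add hbw)
  zero_mem' := ⟨hasWeakDeriv_zero L, 0, continuousOn_const, Lp.coeFn_zero ℝ 2 (vol L), rfl, rfl⟩
  smul_mem' := by
    rintro r a ⟨ha, v, hv, hav, hv0, hvL⟩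
    refine ⟨ha.smul r, r • v, hv.const_smul r, ?_, by simp [hv0], by simp [hvL]⟩
    exact (Lp.coeFn_smul r a.fst).trans (hav.const_smul r)

/-- The element `u` of `H¹₀(0, L)` as an element of `L²(0, L)`. -/
def fn {L : ℝ} (u : H10 L) : L2 L := (u : WithLp 2 (L2 L × L2 L)).fst

/-- The weak derivative `u'` of an element `u` of `H¹₀(0, L)`. -/
def dx {L : ℝ} (u : H10 L) : L2 L := (u : WithLp 2 (L2 L × L2 L)).snd

/-- The weighted norm `‖u‖_{H¹} = (∫ u² + (β/6) ∫ (u')²)^(1/2)`. -/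
def normH1 {L : ℝ} (β : ℝ) (u : H10 L) : ℝ :=
  Real.sqrt (‖fn u‖ ^ 2 + β / 6 * ‖dx u‖ ^ 2)

/-- The norm `‖(u, v)‖_{H¹×H¹} = (‖u‖_{H¹}² + ‖v‖_{H¹}²)^(1/2)`. -/
def normH1H1 {L : ℝ} (β : ℝ) (p : H10 L × H10 L) : ℝ :=
  Real.sqrt (normH1 β p.1 ^ 2 + normH1 β p.2 ^ 2)

/-- `(N, V)` is the solution on `[0, T]`, with coefficient `c`, of
`N_t + V_ξ - (β/6) N_ξξt = 0`, `V_t + (c N)_ξ - (β/6) V_ξξt = 0`,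
with initial data `(N₀, V₀)` and homogeneous Dirichlet boundary conditions: `N(t)` and `V(t)` lie
in `H¹₀(0, L)`, are differentiable in time in `H¹₀(0, L)`, and the weak form of the equations holds
at every time `t ∈ [0, T]` for all test functions in `H¹₀(0, L)`. -/
structure IsSolution (L β T : ℝ) (N₀ V₀ : H10 L) (c : L2 L) (N V : ℝ → H10 L) : Prop where
  initial_N : N 0 = N₀
  initial_V : V 0 = V₀
  equations : ∀ t ∈ Set.Icc 0 T, ∃ Nt Vt : H10 L,
    HasDerivWithinAt N Nt (Set.Icc 0 T) t ∧ HasDerivWithinAt V Vt (Set.Icc 0 T) t ∧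
    (∀ φ : H10 L,
      (∫ x, fn Nt x * fn φ x ∂(vol L)) - (∫ x, fn (V t) x * dx φ x ∂(vol L))
        + β / 6 * (∫ x, dx Nt x * dx φ x ∂(vol L)) = 0) ∧
    (∀ ψ : H10 L,
      (∫ x, fn Vt x * fn ψ x ∂(vol L)) - (∫ x, c x * fn (N t) x * dx ψ x ∂(vol L))
        + β / 6 * (∫ x, dx Vt x * dx ψ x ∂(vol L)) = 0)

/-- The Tikhonov-regularized functional, as a function of the coefficient `c` and of the final
state `(N(T), V(T))`, for the measurement `m = (m₁, m₂)`. -/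
def tikhonov {L : ℝ} (β α : ℝ) (m : H10 L × H10 L) (c : L2 L) (NT VT : H10 L) : ℝ :=
  1 / 2 * normH1 β (NT - m.1) ^ 2 + 1 / 2 * normH1 β (VT - m.2) ^ 2 + α / 2 * ‖c‖ ^ 2

/-- The class `M_γ` of admissible coefficients. -/
def admissible (L γ : ℝ) : Set (L2 L) := {c | ‖c‖ ≤ γ}

/-- `c` is an optimal solution of the restricted minimization problem for the measurement `m` at
the final time `T`: it is admissible, and together with the solution `(N, V)` of the direct problem
that belongs to it, it minimizes the regularized functional among all admissible coefficients `c'`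
and the solutions `(N', V')` that belong to them. -/
def IsOptimal (L β α γ T : ℝ) (N₀ V₀ : H10 L) (m : H10 L × H10 L) (c : L2 L) : Prop :=
  c ∈ admissible L γ ∧ ∃ N V : ℝ → H10 L, IsSolution L β T N₀ V₀ c N V ∧
    ∀ c' ∈ admissible L γ, ∀ N' V' : ℝ → H10 L, IsSolution L β T N₀ V₀ c' N' V' →
      tikhonov β α m c (N T) (V T) ≤ tikhonov β α m c' (N' T) (V' T)

end

end BoussinesqRMP

open BoussinesqRMP

/-! Both minimizers are compared with their midpoint `d = (c + c') / 2`, admissible by convexity.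
Let `g`, `g'`, `e` be the final states for `c`, `c'`, `d`. Adding the two minimality inequalities,
the parallelogram identity for the penalty yields `α/4 ‖c' - c‖²` on the left. Expanding the misfits
around `e` leaves `‖g' + g - 2e‖ ‖e - m‖ + ‖g' - e‖ ‖m' - m‖` on the right
(`norm_sub_sq_le_of_le_midpoint`).

Since `1 - (β/6)∂²` is coercive on `H¹₀` and absorbs the space derivative, the system is an ODE `U'
= (A + B c) U` with bounded operators (`exists_generator`). Here `B` is bounded on `L²` because
`H¹₀` functions are bounded. Gronwall gives `g' - e = O(‖c' - c‖)` and, for the second difference,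
`g' + g - 2e = O(T ‖c' - c‖²)`. For small `T` the penalty absorbs the latter, and one factor `‖c' -
c‖` cancels from what remains. -/

namespace BoussinesqRMP

open Set

/-! ### Stability for bounded linear ODEs controlled bilinearly -/

section AbstractStability

variable {E H F : Type*} [NormedAddCommGroup E] [NormedSpace ℝ E]
  [NormedAddCommGroup H] [InnerProductSpace ℝ H] [NormedAddCommGroup F] [InnerProductSpace ℝ F]

theorem norm_le_exp_of_norm_deriv_le {U U' : ℝ → E} {T K δ ε : ℝ} (hK : 0 < K) (hδ : 0 ≤ δ)
    (hε : 0 ≤ ε) (hT : T ≤ 1)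
    (hU : ∀ t ∈ Icc 0 T, HasDerivWithinAt U (U' t) (Icc 0 T) t) (h0 : ‖U 0‖ ≤ δ)
    (hb : ∀ t ∈ Icc 0 T, ‖U' t‖ ≤ K * ‖U t‖ + ε) :
    ∀ t ∈ Icc 0 T, ‖U t‖ ≤ (δ + ε * T) * Real.exp K := by
  intro t ht
  have h := norm_le_gronwallBound_of_norm_deriv_right_le (f := U) (f' := U') (δ := δ) (K := K)
    (ε := ε) (a := 0) (b := T) (fun s hs => (hU s hs).continuousWithinAt)
    (fun s hs => (hU s (Ico_subset_Icc_self hs)).mono_of_mem_nhdsWithin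
      (Icc_mem_nhdsGE_of_mem hs)) h0 (fun s hs => hb s (Ico_subset_Icc_self hs)) t ht
  rw [gronwallBound_of_K_ne_0 hK.ne', sub_zero] at h
  refine h.trans ?_
  have h1 : Real.exp (K * t) ≤ Real.exp K :=
    Real.exp_le_exp.2 (mul_le_of_le_one_right hK.le (ht.2.trans hT))
  -- From `e^s - 1 ≤ s e^s`: this removes the `1 / K` of the Gronwall bound and keeps the factor `T`
  -- that smallness relies on.
  have h2 : Real.exp (K * t) - 1 ≤ K * t * Real.exp (K * t) := by
    have := mul_le_mul_of_nonneg_right (Real.add_one_le_exp (-(K * t))) (Real.exp_pos (K * t)).le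
    rw [← Real.exp_add, neg_add_cancel, Real.exp_zero] at this
    linarith
  have h3 : ε / K * (Real.exp (K * t) - 1) ≤ ε * T * Real.exp K := by
    calc ε / K * (Real.exp (K * t) - 1) ≤ ε / K * (K * t * Real.exp (K * t)) := by gcongr
      _ = ε * t * Real.exp (K * t) := by field_simp
      _ ≤ ε * T * Real.exp K :=
        mul_le_mul (mul_le_mul_of_nonneg_left ht.2 hε) h1 (Real.exp_pos _).le
          (mul_nonneg hε (ht.1.trans ht.2))
  have h4 : δ * Real.exp (K * t) ≤ δ * Real.exp K := by gcongr
  linarith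

/-- `U` solves the linear differential equation `U' = A U` on `[0, T]` with `U 0 = u₀`. -/
def SolvesLinear (A : E →L[ℝ] E) (u₀ : E) (T : ℝ) (U : ℝ → E) : Prop :=
  U 0 = u₀ ∧ ∀ t ∈ Icc 0 T, HasDerivWithinAt U (A (U t)) (Icc 0 T) t

theorem exists_solvesLinear [CompleteSpace E] (A : E →L[ℝ] E) (u₀ : E) (T : ℝ) :
    ∃ U, SolvesLinear A u₀ T U := by
  refine ⟨fun t => NormedSpace.exp (t • A) u₀, by simp, fun t _ => ?_⟩
  have h := (hasDerivAt_exp_smul_const' (𝕂 := ℝ) A t)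
  simpa using (h.clm_apply (hasDerivAt_const t u₀)).hasDerivWithinAt

theorem SolvesLinear.norm_le {A : E →L[ℝ] E} {u₀ : E} {T K : ℝ} {U : ℝ → E}
    (hU : SolvesLinear A u₀ T U) (hK : 0 < K) (hA : ‖A‖ ≤ K) (hT : T ≤ 1) :
    ∀ t ∈ Icc 0 T, ‖U t‖ ≤ ‖u₀‖ * Real.exp K := by
  have := norm_le_exp_of_norm_deriv_le hK (norm_nonneg u₀) le_rfl hT hU.2 (by rw [hU.1])
    (fun t _ => by simpa using A.le_of_opNorm_le hA (U t))
  simpa using this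

/-- Gronwall for `V - U`, which starts at zero and is driven by the generator `A + D` with source `D
U`. -/
theorem SolvesLinear.norm_sub_le {A D : E →L[ℝ] E} {u₀ : E} {T K : ℝ} {U V : ℝ → E}
    (hU : SolvesLinear A u₀ T U) (hV : SolvesLinear (A + D) u₀ T V) (hK : 0 < K) (hA : ‖A‖ ≤ K)
    (hAD : ‖A + D‖ ≤ K) (hT : T ≤ 1) :
    ∀ t ∈ Icc 0 T, ‖V t - U t‖ ≤ ‖D‖ * ‖u₀‖ * Real.exp K ^ 2 * T := by
  intro t ht
  have h := norm_le_exp_of_norm_deriv_le (U := fun t => V t - U t) hK le_rfl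
    (ε := ‖D‖ * (‖u₀‖ * Real.exp K)) (by positivity) hT
    (fun t ht => (hV.2 t ht).sub (hU.2 t ht)) (by simp [hU.1, hV.1]) (fun t ht => ?_) t ht
  · refine h.trans_eq ?_
    ring
  · have e : (A + D) (V t) - A (U t) = (A + D) (V t - U t) + D (U t) := by
      simp only [add_apply, map_sub]
      abel
    rw [e]
    exact (norm_add_le _ _).trans (add_le_add ((A + D).le_of_opNorm_le hAD _)
      (D.le_opNorm_of_le (hU.norm_le hK hA hT t ht)))

/-- The second difference starts at zero and is driven by `A` with source `D (V - U) - D (W - U)`,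
already of size `‖D‖² T`. Gronwall gives `T²`, weakened to `T`. -/
theorem SolvesLinear.norm_add_sub_two_smul_le {A D : E →L[ℝ] E} {u₀ : E} {T K : ℝ}
    {U V W : ℝ → E} (hU : SolvesLinear A u₀ T U) (hV : SolvesLinear (A + D) u₀ T V)
    (hW : SolvesLinear (A - D) u₀ T W) (hK : 0 < K) (hA : ‖A‖ ≤ K) (hAD : ‖A + D‖ ≤ K)
    (hAD' : ‖A - D‖ ≤ K) (hT0 : 0 ≤ T) (hT : T ≤ 1) :
    ∀ t ∈ Icc 0 T, ‖V t + W t - (2 : ℝ) • U t‖ ≤ 2 * ‖D‖ ^ 2 * ‖u₀‖ * Real.exp K ^ 3 * T := by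
  intro t ht
  have hV' := hU.norm_sub_le hV hK hA hAD hT
  have hW' := hU.norm_sub_le (D := -D) (by rwa [← sub_eq_add_neg]) hK hA
    (by rwa [← sub_eq_add_neg]) hT
  have h := norm_le_exp_of_norm_deriv_le (U := fun t => V t + W t - (2 : ℝ) • U t) hK le_rfl
    (ε := 2 * (‖D‖ * (‖D‖ * ‖u₀‖ * Real.exp K ^ 2 * T))) (by positivity) hT
    (fun t ht => ((hV.2 t ht).add (hW.2 t ht)).sub ((hU.2 t ht).const_smul (2 : ℝ)))
    (by simp [hU.1, hV.1, hW.1, two_smul]) (fun t ht => ?_) t ht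
  · calc _ ≤ _ := h
      _ = 2 * ‖D‖ ^ 2 * ‖u₀‖ * Real.exp K ^ 3 * (T * T) := by ring
      _ ≤ _ := by
        gcongr
        exact mul_le_of_le_one_right hT0 hT
  · have e : (A + D) (V t) + (A - D) (W t) - (2 : ℝ) • A (U t)
        = A (V t + W t - (2 : ℝ) • U t) + (D (V t - U t) + -D (W t - U t)) := by
      simp only [add_apply, sub_apply, map_sub, map_add,
        map_smul]
      abel
    rw [e]
    refine (norm_add_le _ _).trans (add_le_add (A.le_of_opNorm_le hA _) ?_)
    refine (norm_add_le _ _).trans ?_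
    rw [two_mul, norm_neg]
    refine add_le_add (D.le_opNorm_of_le (hV' t ht)) (D.le_opNorm_of_le ?_)
    simpa using hW' t ht

/-- Two minimizers compared through their midpoint. -/
theorem norm_sub_sq_le_of_le_midpoint {α : ℝ} {c c' : H} {g g' e m m' : F}
    (h : 1 / 2 * ‖g - m‖ ^ 2 + α / 2 * ‖c‖ ^ 2
      ≤ 1 / 2 * ‖e - m‖ ^ 2 + α / 2 * ‖(1 / 2 : ℝ) • (c + c')‖ ^ 2)
    (h' : 1 / 2 * ‖g' - m'‖ ^ 2 + α / 2 * ‖c'‖ ^ 2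
      ≤ 1 / 2 * ‖e - m'‖ ^ 2 + α / 2 * ‖(1 / 2 : ℝ) • (c + c')‖ ^ 2) :
    α / 4 * ‖c' - c‖ ^ 2
      ≤ ‖g' + g - (2 : ℝ) • e‖ * ‖e - m‖ + ‖g' - e‖ * ‖m' - m‖ := by
  have e1 : ‖g - m‖ ^ 2 = ‖g - e‖ ^ 2 + 2 * inner ℝ (g - e) (e - m) + ‖e - m‖ ^ 2 := by
    rw [← norm_add_sq_real, sub_add_sub_cancel]
  have e2 : ‖g' - m'‖ ^ 2 = ‖g' - e‖ ^ 2 + 2 * inner ℝ (g' - e) (e - m') + ‖e - m'‖ ^ 2 := by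
    rw [← norm_add_sq_real, sub_add_sub_cancel]
  have e3 : inner ℝ (g - e) (e - m) + inner ℝ (g' - e) (e - m')
      = inner ℝ (g' + g - (2 : ℝ) • e) (e - m) - inner ℝ (g' - e) (m' - m) := by
    simp only [two_smul, inner_sub_left, inner_sub_right, inner_add_left]
    ring
  have e4 : ‖(1 / 2 : ℝ) • (c + c')‖ ^ 2 = 1 / 2 * (‖c‖ ^ 2 + ‖c'‖ ^ 2) - 1 / 4 * ‖c' - c‖ ^ 2 := by
    rw [norm_smul, mul_pow, norm_add_sq_real, norm_sub_sq_real, real_inner_comm c c']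
    norm_num
    ring
  have i1 := neg_le_of_abs_le (abs_real_inner_le_norm (g' + g - (2 : ℝ) • e) (e - m))
  have i2 := real_inner_le_norm (g' - e) (m' - m)
  rw [e4] at h h'
  nlinarith [sq_nonneg ‖g - e‖, sq_nonneg ‖g' - e‖]

/-- Only the observation space `F` and the control space `H` need inner products; the state space
`E` may carry any complete norm. -/
theorem exists_stability_of_bilinear_ode [CompleteSpace E] (A : E →L[ℝ] E)
    (B : H →L[ℝ] E →L[ℝ] E) (Φ : E →L[ℝ] F) (u₀ : E) {α γ : ℝ} (hα : 0 < α) (hγ : 0 ≤ γ) (ρ : ℝ) :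
    ∃ T₀ > 0, ∃ S > 0, ∀ T : ℝ, 0 < T → T ≤ T₀ → ∀ m m' : F, ‖m‖ ≤ ρ →
      ∀ c c' : H, ‖c‖ ≤ γ → ‖c'‖ ≤ γ →
      ∀ U U' : ℝ → E, SolvesLinear (A + B c) u₀ T U → SolvesLinear (A + B c') u₀ T U' →
      (∀ d : H, ‖d‖ ≤ γ → ∀ V : ℝ → E, SolvesLinear (A + B d) u₀ T V →
        1 / 2 * ‖Φ (U T) - m‖ ^ 2 + α / 2 * ‖c‖ ^ 2
          ≤ 1 / 2 * ‖Φ (V T) - m‖ ^ 2 + α / 2 * ‖d‖ ^ 2) →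
      (∀ d : H, ‖d‖ ≤ γ → ∀ V : ℝ → E, SolvesLinear (A + B d) u₀ T V →
        1 / 2 * ‖Φ (U' T) - m'‖ ^ 2 + α / 2 * ‖c'‖ ^ 2
          ≤ 1 / 2 * ‖Φ (V T) - m'‖ ^ 2 + α / 2 * ‖d‖ ^ 2) →
      ‖c' - c‖ ≤ S * ‖m' - m‖ := by
  -- `K` bounds every admissible generator. `P` and `Q` govern the second and first differences at
  -- time `T`, and `R` the residual at the midpoint. The halves come from `c` and `c'` lying at
  -- distance `‖c' - c‖ / 2` from the midpoint.
  obtain ⟨K, hKdef⟩ : ∃ K : ℝ, K = ‖A‖ + ‖B‖ * γ + 1 := ⟨_, rfl⟩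
  have hK : 0 < K := by rw [hKdef]; positivity
  obtain ⟨P, hP⟩ : ∃ P : ℝ, P = ‖Φ‖ * (2 * (‖B‖ / 2) ^ 2 * ‖u₀‖ * Real.exp K ^ 3) := ⟨_, rfl⟩
  obtain ⟨R, hR⟩ : ∃ R : ℝ, R = ‖Φ‖ * (‖u₀‖ * Real.exp K) + |ρ| := ⟨_, rfl⟩
  obtain ⟨Q, hQ⟩ : ∃ Q : ℝ, Q = ‖Φ‖ * (‖B‖ / 2 * ‖u₀‖ * Real.exp K ^ 2) := ⟨_, rfl⟩
  have hP0 : 0 ≤ P := by rw [hP]; positivity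
  have hR0 : 0 ≤ R := by rw [hR]; positivity
  have hQ0 : 0 ≤ Q := by rw [hQ]; positivity
  have hPR : 0 < P * R + 1 := by positivity
  have hBK : ∀ d : H, ‖d‖ ≤ γ → ‖A + B d‖ ≤ K := fun d hd =>
    (norm_add_le _ _).trans (by rw [hKdef]; linarith [B.le_opNorm_of_le hd])
  -- Half of the coercivity constant `α / 4` absorbs the second difference; the other half gives `8
  -- * Q / α`. The added ones only ensure positivity.
  refine ⟨min 1 (α / 8 / (P * R + 1)), by positivity, 8 * Q / α + 1, by positivity, ?_⟩
  intro T hT0 hT m m' hm c c' hc hc' U U' hU hU' hopt hopt'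
  have hT1 : T ≤ 1 := hT.trans (min_le_left _ _)
  have hT2 : T * (P * R + 1) ≤ α / 8 := (le_div_iff₀ hPR).1 (hT.trans (min_le_right _ _))
  have hTm : T ∈ Icc 0 T := ⟨hT0.le, le_rfl⟩
  obtain ⟨d, hd⟩ : ∃ d : H, d = (1 / 2 : ℝ) • (c + c') := ⟨_, rfl⟩
  have hdγ : ‖d‖ ≤ γ := by
    rw [hd, norm_smul]
    have := norm_add_le c c'
    norm_num
    linarith
  -- Minimality speaks only of trajectories that exist, so the midpoint needs one.
  obtain ⟨V, hV⟩ := exists_solvesLinear (A + B d) u₀ T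
  obtain ⟨D, hD⟩ : ∃ D : E →L[ℝ] E, D = B ((1 / 2 : ℝ) • (c' - c)) := ⟨_, rfl⟩
  have hDn : ‖D‖ ≤ ‖B‖ / 2 * ‖c' - c‖ := by
    rw [hD]
    refine (B.le_opNorm _).trans_eq ?_
    rw [norm_smul]
    norm_num
    ring
  have hc'D : A + B c' = A + B d + D := by
    rw [hD, hd, add_assoc, ← map_add, ← smul_add]
    congr 2
    module
  have hcD : A + B c = A + B d - D := by
    rw [hD, hd, add_sub_assoc, ← map_sub, ← smul_sub]
    congr 2
    module
  have b0 := hBK d hdγ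
  have b1 := hBK c hc
  have b2 := hBK c' hc'
  rw [hcD] at hU b1
  rw [hc'D] at hU' b2
  have n0 : ‖Φ (V T) - m‖ ≤ R :=
    (norm_sub_le _ _).trans (add_le_add (Φ.le_opNorm_of_le (hV.norm_le hK b0 hT1 T hTm))
      (hm.trans (le_abs_self ρ))) |>.trans_eq hR.symm
  have n1 : ‖Φ (U' T) - Φ (V T)‖ ≤ Q * ‖c' - c‖ := by
    rw [← map_sub]
    refine (Φ.le_opNorm_of_le (hV.norm_sub_le hU' hK b0 b2 hT1 T hTm)).trans ?_
    calc _ ≤ ‖Φ‖ * (‖B‖ / 2 * ‖c' - c‖ * ‖u₀‖ * Real.exp K ^ 2 * 1) := by gcongr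
      _ = _ := by rw [hQ]; ring
  have n2 : ‖Φ (U' T) + Φ (U T) - (2 : ℝ) • Φ (V T)‖ ≤ P * ‖c' - c‖ ^ 2 * T := by
    rw [← map_add, ← map_smul, ← map_sub]
    refine (Φ.le_opNorm_of_le
      (hV.norm_add_sub_two_smul_le hU' hU hK b0 b2 b1 hT0.le hT1 T hTm)).trans ?_
    calc _ ≤ ‖Φ‖ * (2 * (‖B‖ / 2 * ‖c' - c‖) ^ 2 * ‖u₀‖ * Real.exp K ^ 3 * T) := by gcongr
      _ = _ := by rw [hP]; ring
  have key := norm_sub_sq_le_of_le_midpoint (hd ▸ hopt d hdγ V hV) (hd ▸ hopt' d hdγ V hV)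
  have k1 : ‖Φ (U' T) + Φ (U T) - (2 : ℝ) • Φ (V T)‖ * ‖Φ (V T) - m‖
      ≤ α / 8 * ‖c' - c‖ ^ 2 := by
    calc _ ≤ P * ‖c' - c‖ ^ 2 * T * R := by gcongr
      _ ≤ T * (P * R + 1) * ‖c' - c‖ ^ 2 := by
        linarith [mul_nonneg hT0.le (sq_nonneg ‖c' - c‖)]
      _ ≤ _ := by gcongr
  have k2 : ‖Φ (U' T) - Φ (V T)‖ * ‖m' - m‖ ≤ Q * ‖c' - c‖ * ‖m' - m‖ := by gcongr
  rcases (norm_nonneg (c' - c)).eq_or_lt with h0 | h0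
  · rw [← h0]
    positivity
  have k3 : α / 8 * ‖c' - c‖ ≤ Q * ‖m' - m‖ := by
    refine le_of_mul_le_mul_right ?_ h0
    linarith
  have k4 : ‖c' - c‖ ≤ 8 * Q / α * ‖m' - m‖ := by
    rw [div_mul_eq_mul_div, le_div_iff₀ hα]
    linarith
  linarith [norm_nonneg (m' - m)]

end AbstractStability

/-! ### The du Bois-Reymond lemma -/

/-- A primitive of a compactly supported smooth function with integral zero is a test function. -/
theorem exists_primitive_test {L : ℝ} (hL : 0 < L) {ψ : ℝ → ℝ} (hψ : ContDiff ℝ (⊤ : ℕ∞) ψ)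
    {K : Set ℝ} (hK : IsCompact K) (hne : K.Nonempty) (hKL : K ⊆ Ioo 0 L) (hψK : ∀ x ∉ K, ψ x = 0)
    (h0 : ∫ x, ψ x ∂(vol L) = 0) :
    ∃ φ : ℝ → ℝ, ContDiff ℝ (⊤ : ℕ∞) φ ∧ HasCompactSupport φ ∧ tsupport φ ⊆ Ioo 0 L ∧
      deriv φ = ψ := by
  have hd : deriv (fun x => ∫ y in (0 : ℝ)..x, ψ y) = ψ :=
    funext fun x => hψ.continuous.deriv_integral ψ 0 x
  have hdiff : Differentiable ℝ (fun x => ∫ y in (0 : ℝ)..x, ψ y) := fun x =>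
    (hψ.continuous.integral_hasStrictDerivAt 0 x).hasDerivAt.differentiableAt
  obtain ⟨a, ha⟩ := hK.exists_isLeast hne
  obtain ⟨b, hb⟩ := hK.exists_isGreatest hne
  have ha0 := (hKL ha.1).1
  have hbL := (hKL hb.1).2
  have hi : ∀ x y : ℝ, IntervalIntegrable ψ volume x y := fun x y =>
    hψ.continuous.intervalIntegrable x y
  have hz : ∀ x y : ℝ, (∀ z ∈ uIcc x y, z ∉ K) → ∫ t in x..y, ψ t = 0 := fun x y hxy => by
    rw [intervalIntegral.integral_congr (g := fun _ => 0) (fun z hz => hψK z (hxy z hz))]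
    simp
  -- Left of `a` the integrand vanishes; right of `b` the whole integral has been collected, and it
  -- is zero.
  have hout : ∀ x ∉ Icc a b, ∫ y in (0 : ℝ)..x, ψ y = 0 := by
    intro x hx
    rcases lt_or_ge x a with hxa | hxa
    · refine hz 0 x fun z hz hzK => ?_
      have h1 := hz.2
      have h2 := ha.2 hzK
      rcases le_max_iff.1 h1 with h | h <;> linarith
    · have hxb : b < x := by
        by_contra h
        exact hx ⟨hxa, not_lt.1 h⟩
      rw [← intervalIntegral.integral_add_adjacent_intervals (hi 0 L) (hi L x),
        intervalIntegral.integral_of_le hL.le, integral_Ioc_eq_integral_Ioo, h0, zero_add]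
      refine hz L x fun z hz hzK => ?_
      have h1 := hz.1
      have h2 := hb.2 hzK
      rcases min_le_iff.1 h1 with h | h <;> linarith
  refine ⟨_, contDiff_infty_iff_deriv.2 ⟨hdiff, by rwa [hd]⟩,
    HasCompactSupport.intro isCompact_Icc hout, ?_, hd⟩
  refine (closure_minimal (fun x hx => ?_) isClosed_Icc).trans (Icc_subset_Ioo ha0 hbL)
  by_contra h
  exact hx (hout x h)

/-- The du Bois-Reymond lemma: a function whose weak derivative vanishes is constant. -/
theorem exists_ae_eq_const_of_integral_mul_deriv_eq_zero {L : ℝ} (hL : 0 < L) {w : ℝ → ℝ}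
    (hw : Integrable w (vol L))
    (h : ∀ φ : ℝ → ℝ, ContDiff ℝ (⊤ : ℕ∞) φ → HasCompactSupport φ → tsupport φ ⊆ Ioo 0 L →
      ∫ x, w x * deriv φ x ∂(vol L) = 0) :
    ∃ k : ℝ, ∀ᵐ x ∂(vol L), w x = k := by
  let f : ContDiffBump (L / 2) := ⟨L / 8, L / 4, by positivity, by linarith⟩
  obtain ⟨η, hη⟩ : ∃ η, η = f.normed volume := ⟨_, rfl⟩
  have hηs : ContDiff ℝ (⊤ : ℕ∞) η := hη ▸ f.contDiff_normed
  have hηt : tsupport η = Metric.closedBall (L / 2) (L / 4) := hη ▸ f.tsupport_normed_eq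
  have hηL : tsupport η ⊆ Ioo 0 L := by
    rw [hηt, Real.closedBall_eq_Icc]
    exact Icc_subset_Ioo (by linarith) (by linarith)
  have hηc : HasCompactSupport η := hη ▸ f.hasCompactSupport_normed
  have hηi : ∫ x, η x ∂(vol L) = 1 := by
    rw [setIntegral_eq_integral_of_forall_compl_eq_zero
      fun x hx => image_eq_zero_of_notMem_tsupport fun hx' => hx (hηL hx')]
    exact hη ▸ f.integral_normed
  have hmul : ∀ g : ℝ → ℝ, Continuous g → HasCompactSupport g →
      Integrable (fun x => w x * g x) (vol L) := fun g hg hgc => by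
    obtain ⟨C, hC⟩ := hgc.exists_bound_of_continuous hg
    exact hw.mul_bdd hg.aestronglyMeasurable (Filter.Eventually.of_forall hC)
  obtain ⟨k, hk⟩ : ∃ k, k = ∫ x, w x * η x ∂(vol L) := ⟨_, rfl⟩
  refine ⟨k, ?_⟩
  have hwk : IntegrableOn (fun x => w x - k) (Ioo 0 L) volume := hw.sub (integrable_const k)
  -- Subtracting `I * η`, with `η` of mass one, makes any test function `g` a derivative. So `∫ g (w
  -- - k) = ∫ w (g - I η) = 0`.
  have key := isOpen_Ioo.ae_eq_zero_of_integral_contDiff_smul_eq_zero (U := Ioo 0 L)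
    hwk.locallyIntegrableOn fun g hg hgc hgL => ?_
  · rw [ae_restrict_iff' measurableSet_Ioo]
    filter_upwards [key] with x hx hxL
    exact sub_eq_zero.1 (hx hxL)
  · rw [← setIntegral_eq_integral_of_forall_compl_eq_zero (s := Ioo 0 L)
      fun x hx => by rw [image_eq_zero_of_notMem_tsupport fun hx' => hx (hgL hx'), zero_smul]]
    obtain ⟨I, hI⟩ : ∃ I, I = ∫ x, g x ∂(vol L) := ⟨_, rfl⟩
    have hgi : Integrable g (vol L) := (hg.continuous.integrable_of_hasCompactSupport hgc).restrict
    have hηi' : Integrable η (vol L) :=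
      (hηs.continuous.integrable_of_hasCompactSupport hηc).restrict
    obtain ⟨φ, hφ, hφc, hφL, hφd⟩ := exists_primitive_test hL (ψ := fun x => g x - I * η x)
      (hg.sub (contDiff_const.mul hηs)) (K := tsupport g ∪ tsupport η) (hgc.union hηc)
      (by rw [hηt]; exact ⟨L / 2, Or.inr (Metric.mem_closedBall_self (by positivity))⟩)
      (union_subset hgL hηL) (fun x hx => by
        rw [mem_union, not_or] at hx
        simp only [image_eq_zero_of_notMem_tsupport hx.1, image_eq_zero_of_notMem_tsupport hx.2,
          mul_zero, sub_zero])
      (by rw [integral_sub hgi (hηi'.const_mul I), integral_const_mul, hηi, ← hI]; ring)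
    have h1 := h φ hφ hφc hφL
    rw [hφd] at h1
    have e1 : ∫ x, w x * (g x - I * η x) ∂(vol L) = (∫ x, w x * g x ∂(vol L)) - I * k := by
      rw [hk, ← integral_const_mul, ← integral_sub (hmul g hg.continuous hgc)
        ((hmul η hηs.continuous hηc).const_mul I)]
      congr 1
      ext x
      ring
    have e2 : ∫ x, g x • (w x - k) ∂(vol L) = (∫ x, w x * g x ∂(vol L)) - k * I := by
      rw [hI, ← integral_const_mul, ← integral_sub (hmul g hg.continuous hgc) (hgi.const_mul k)]
      congr 1
      ext x
      rw [smul_eq_mul]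
      ring
    rw [e2]
    linarith

/-! ### Primitives and completeness of `H¹₀` -/

theorem intervalIntegrable_L2 {L : ℝ} (g : L2 L) {x : ℝ} (hx : x ∈ Icc 0 L) :
    IntervalIntegrable g volume 0 x := by
  have h : Integrable g (vol L) := (Lp.memLp g).integrable (by norm_num)
  rw [intervalIntegrable_iff_integrableOn_Ioo_of_le hx.1]
  exact h.mono_measure (Measure.restrict_mono (Ioo_subset_Ioo_right hx.2) le_rfl)

/-- The primitive of `g ∈ L²(0, L)` that vanishes at `0`. -/
noncomputable def prim {L : ℝ} (g : L2 L) (x : ℝ) : ℝ := ∫ y in (0 : ℝ)..x, g y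

theorem prim_zero_right {L : ℝ} (g : L2 L) : prim g 0 = 0 := intervalIntegral.integral_same

/-- Writing evaluation of the primitive as a pairing with an indicator gives linearity, and by
Cauchy–Schwarz a uniform bound. -/
theorem prim_eq_inner {L : ℝ} (g : L2 L) {x : ℝ} (hx : x ∈ Icc 0 L) :
    prim g x = inner ℝ (indicatorConstLp 2 (measurableSet_Ioo (a := 0) (b := x))
      (measure_ne_top (vol L) _) (1 : ℝ)) g := by
  rw [L2.inner_indicatorConstLp_one, prim, intervalIntegral.integral_of_le hx.1,
    integral_Ioc_eq_integral_Ioo, Measure.restrict_restrict measurableSet_Ioo,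
    inter_eq_left.2 (Ioo_subset_Ioo_right hx.2)]

theorem prim_add {L : ℝ} (g g' : L2 L) {x : ℝ} (hx : x ∈ Icc 0 L) :
    prim (g + g') x = prim g x + prim g' x := by
  simp only [prim_eq_inner _ hx, inner_add_right]

theorem prim_smul {L : ℝ} (a : ℝ) (g : L2 L) {x : ℝ} (hx : x ∈ Icc 0 L) :
    prim (a • g) x = a * prim g x := by
  simp only [prim_eq_inner _ hx, inner_smul_right]

theorem exists_abs_prim_le (L : ℝ) :
    ∃ C : ℝ, 0 ≤ C ∧ ∀ (g : L2 L), ∀ x ∈ Icc 0 L, |prim g x| ≤ C * ‖g‖ := by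
  refine ⟨(vol L).real univ ^ (1 / 2 : ℝ), by positivity, fun g x hx => ?_⟩
  rw [prim_eq_inner g hx]
  refine (abs_real_inner_le_norm _ _).trans ?_
  gcongr
  rw [norm_indicatorConstLp (by norm_num) (by norm_num)]
  simp only [norm_one, one_mul, ENNReal.toReal_ofNat]
  gcongr
  · exact measure_ne_top _ _
  · exact subset_univ _

theorem continuousOn_prim {L : ℝ} (hL : 0 < L) (g : L2 L) : ContinuousOn (prim g) (Icc 0 L) := by
  have h := intervalIntegrable_L2 g (right_mem_Icc.2 hL.le)
  have := (h.absolutelyContinuousOnInterval_intervalIntegral left_mem_uIcc).continuousOn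
  rwa [uIcc_of_le hL.le] at this

theorem integral_prim_mul_deriv {L : ℝ} (hL : 0 < L) (g : L2 L) {φ : ℝ → ℝ}
    (hφ : ContDiff ℝ (⊤ : ℕ∞) φ) (hs : tsupport φ ⊆ Ioo 0 L) :
    ∫ x, prim g x * deriv φ x ∂(vol L) = -∫ x, g x * φ x ∂(vol L) := by
  have hi := intervalIntegrable_L2 g (right_mem_Icc.2 hL.le)
  have h := (hi.absolutelyContinuousOnInterval_intervalIntegral
    left_mem_uIcc).integral_mul_deriv_eq_deriv_mul
    (ContDiffOn.absolutelyContinuousOnInterval ((hφ.of_le (by exact_mod_cast le_top)).contDiffOn))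
  have h0 : φ 0 = 0 := image_eq_zero_of_notMem_tsupport fun h => lt_irrefl _ (hs h).1
  have h1 : φ L = 0 := image_eq_zero_of_notMem_tsupport fun h => lt_irrefl _ (hs h).2
  have e : ∫ x in (0 : ℝ)..L, deriv (fun x => ∫ y in (0 : ℝ)..x, g y) x * φ x
      = ∫ x in (0 : ℝ)..L, g x * φ x := by
    refine intervalIntegral.integral_congr_ae ?_
    filter_upwards [hi.ae_hasDerivAt_integral] with x hx hxL
    rw [(hx (uIoc_subset_uIcc hxL) 0 left_mem_uIcc).deriv]
  rw [h0, h1, mul_zero, mul_zero, sub_zero, zero_sub, e, intervalIntegral.integral_of_le hL.le,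
    intervalIntegral.integral_of_le hL.le, integral_Ioc_eq_integral_Ioo,
    integral_Ioc_eq_integral_Ioo] at h
  exact h

/-- `u` minus the primitive of `u'` has zero weak derivative, hence is constant; the boundary values
fix the constant and the condition at `L`. -/
theorem mem_H10_iff {L : ℝ} (hL : 0 < L) (w : WithLp 2 (L2 L × L2 L)) :
    w ∈ H10 L ↔ w.fst =ᵐ[vol L] prim w.snd ∧ prim w.snd L = 0 := by
  have hLm := right_mem_Icc.2 hL.le
  constructor
  · rintro ⟨hd, v, hv, huv, hv0, hvL⟩
    have hpi : Integrable (prim w.snd) (vol L) :=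
      ((continuousOn_prim hL w.snd).integrableOn_compact isCompact_Icc).mono_set Ioo_subset_Icc_self
    have hui : Integrable w.fst (vol L) := (Lp.memLp w.fst).integrable (by norm_num)
    obtain ⟨k, hk⟩ := exists_ae_eq_const_of_integral_mul_deriv_eq_zero hL (hui.sub hpi)
      fun φ hφ hc hs => by
        have hdc : Continuous (deriv φ) := hφ.continuous_deriv (by exact_mod_cast le_top)
        obtain ⟨C, hC⟩ := hc.deriv.exists_bound_of_continuous hdc
        simp only [Pi.sub_apply, sub_mul]
        rw [integral_sub (integrable_mul_test w.fst hdc hc.deriv)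
          (hpi.mul_bdd hdc.aestronglyMeasurable (Filter.Eventually.of_forall hC)),
          integral_prim_mul_deriv hL _ hφ hs, hd φ hφ hc hs, sub_self]
    -- Continuity upgrades almost everywhere equality to the closed interval, so the end values can
    -- be compared.
    have hE : EqOn v (fun x => prim w.snd x + k) (Icc 0 L) := by
      refine Measure.eqOn_Icc_of_ae_eq volume hL.ne ?_ hv
        ((continuousOn_prim hL w.snd).add continuousOn_const)
      rw [← restrict_Ioo_eq_restrict_Icc]
      filter_upwards [huv, hk] with x hx hx'
      rw [← hx, ← hx', Pi.sub_apply]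
      ring
    have h0 := hE (left_mem_Icc.2 hL.le)
    have h1 := hE hLm
    simp only [hv0, hvL, prim_zero_right, zero_add] at h0 h1
    refine ⟨?_, by linarith⟩
    filter_upwards [hk] with x hx
    rw [← h0, Pi.sub_apply] at hx
    exact sub_eq_zero.1 hx
  · rintro ⟨h1, h2⟩
    refine ⟨fun φ hφ _ hs => ?_, prim w.snd, continuousOn_prim hL _, h1, prim_zero_right _, h2⟩
    rw [← integral_prim_mul_deriv hL _ hφ hs]
    refine integral_congr_ae ?_
    filter_upwards [h1] with x hx
    rw [hx]

theorem exists_primitive_clm {L : ℝ} (hL : 0 < L) :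
    ∃ P : L2 L →L[ℝ] L2 L, ∀ g, P g =ᵐ[vol L] prim g := by
  obtain ⟨C, hC, hb⟩ := exists_abs_prim_le L
  have hmem : ∀ᵐ x ∂(vol L), x ∈ Icc 0 L :=
    (ae_restrict_mem measurableSet_Ioo).mono fun x hx => Ioo_subset_Icc_self hx
  have hbd : ∀ g : L2 L, ∀ᵐ x ∂(vol L), ‖prim g x‖ ≤ C * ‖g‖ := fun g => by
    filter_upwards [hmem] with x hx using hb g x hx
  have hm : ∀ g : L2 L, MemLp (prim g) 2 (vol L) := fun g =>
    MemLp.of_bound (((continuousOn_prim hL g).mono Ioo_subset_Icc_self).aestronglyMeasurable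
      measurableSet_Ioo) _ (hbd g)
  let P : L2 L →ₗ[ℝ] L2 L :=
    { toFun := fun g => (hm g).toLp _
      map_add' := fun g g' => by
        rw [← MemLp.toLp_add]
        refine MemLp.toLp_congr _ _ ?_
        filter_upwards [hmem] with x hx using prim_add g g' hx
      map_smul' := fun a g => by
        rw [RingHom.id_apply, ← MemLp.toLp_const_smul]
        refine MemLp.toLp_congr _ _ ?_
        filter_upwards [hmem] with x hx using prim_smul a g hx }
  refine ⟨P.mkContinuous (measureUnivNNReal (vol L) ^ (2 : ENNReal).toReal⁻¹ * C) fun g => ?_,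
    fun g => (hm g).coeFn_toLp⟩
  rw [mul_assoc]
  refine Lp.norm_le_of_ae_bound (by positivity) ?_
  filter_upwards [(hm g).coeFn_toLp, hbd g] with x hx hx'
  rwa [LinearMap.coe_mk, AddHom.coe_mk, hx]

/-- The description by primitives consists of two closed conditions, `u = P u'` and `⟨1, u'⟩ = 0`.
-/
theorem completeSpace_H10 {L : ℝ} (hL : 0 < L) : CompleteSpace (H10 L) := by
  obtain ⟨P, hP⟩ := exists_primitive_clm hL
  have hLm := right_mem_Icc.2 hL.le
  have e : (H10 L : Set (WithLp 2 (L2 L × L2 L))) = {w | w.fst = P w.snd} ∩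
      {w | inner ℝ (indicatorConstLp 2 (measurableSet_Ioo (a := 0) (b := L))
        (measure_ne_top (vol L) _) (1 : ℝ)) w.snd = 0} := by
    ext w
    rw [SetLike.mem_coe, mem_H10_iff hL, mem_inter_iff, mem_ofPred_eq, mem_ofPred_eq,
      ← prim_eq_inner _ hLm, Lp.ext_iff]
    exact and_congr_left' ⟨fun h => h.trans (hP _).symm, fun h => h.trans (hP _)⟩
  have hf : Continuous fun w : WithLp 2 (L2 L × L2 L) => w.fst := (WithLp.fstL 2 ℝ _ _).continuous
  have hs : Continuous fun w : WithLp 2 (L2 L × L2 L) => w.snd := (WithLp.sndL 2 ℝ _ _).continuous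
  have hc : IsClosed (H10 L : Set (WithLp 2 (L2 L × L2 L))) := by
    rw [e]
    exact (isClosed_eq hf (P.continuous.comp hs)).inter
      (isClosed_eq (continuous_const.inner hs) continuous_const)
  exact hc.completeSpace_coe

/-! ### The weak equations as a bounded evolution equation -/

/-- `fn` as a continuous linear map. -/
noncomputable def fnL (L : ℝ) : H10 L →L[ℝ] L2 L := (WithLp.fstL 2 ℝ _ _).comp (H10 L).subtypeL

/-- `dx` as a continuous linear map. -/
noncomputable def dxL (L : ℝ) : H10 L →L[ℝ] L2 L := (WithLp.sndL 2 ℝ _ _).comp (H10 L).subtypeL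

theorem fnL_apply {L : ℝ} (u : H10 L) : fnL L u = fn u := rfl

theorem dxL_apply {L : ℝ} (u : H10 L) : dxL L u = dx u := rfl

theorem norm_sq_eq {L : ℝ} (u : H10 L) : ‖u‖ ^ 2 = ‖fn u‖ ^ 2 + ‖dx u‖ ^ 2 :=
  WithLp.prod_norm_sq_eq_of_L2 (u : WithLp 2 (L2 L × L2 L))

theorem norm_dx_le {L : ℝ} (u : H10 L) : ‖dx u‖ ≤ ‖u‖ := by
  refine le_of_sq_le_sq ?_ (norm_nonneg u)
  rw [norm_sq_eq]
  exact le_add_of_nonneg_left (sq_nonneg _)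

/-- An `L²` coefficient times `u` stays in `L²` because `u`, being the primitive of `u'`, is bounded
by `C ‖u‖`. -/
theorem exists_mul_clm {L : ℝ} (hL : 0 < L) :
    ∃ M : L2 L →L[ℝ] H10 L →L[ℝ] L2 L, ∀ c u, M c u =ᵐ[vol L] fun x => c x * fn u x := by
  obtain ⟨C, hC, hb⟩ := exists_abs_prim_le L
  have hbd : ∀ (c : L2 L) (u : H10 L), ∀ᵐ x ∂(vol L),
      ‖c x * fn u x‖ ≤ C * ‖u‖ * ‖c x‖ := fun c u => by
    filter_upwards [((mem_H10_iff hL _).1 u.2).1, ae_restrict_mem measurableSet_Ioo] with x hx hx'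
    rw [norm_mul, mul_comm]
    gcongr
    rw [fn, hx]
    exact (hb _ x (Ioo_subset_Icc_self hx')).trans
      (mul_le_mul_of_nonneg_left (norm_dx_le u) hC)
  have hm : ∀ (c : L2 L) (u : H10 L), MemLp (fun x => c x * fn u x) 2 (vol L) := fun c u =>
    (Lp.memLp c).of_le_mul ((Lp.aestronglyMeasurable c).mul (Lp.aestronglyMeasurable (fn u)))
      (hbd c u)
  let M : L2 L →ₗ[ℝ] H10 L →ₗ[ℝ] L2 L := LinearMap.mk₂ ℝ (fun c u => (hm c u).toLp _)
    (fun c c' u => by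
      rw [← MemLp.toLp_add]
      refine MemLp.toLp_congr _ _ ?_
      filter_upwards [Lp.coeFn_add c c'] with x hx
      rw [hx, Pi.add_apply, Pi.add_apply, add_mul])
    (fun a c u => by
      rw [← MemLp.toLp_const_smul]
      refine MemLp.toLp_congr _ _ ?_
      filter_upwards [Lp.coeFn_smul a c] with x hx
      rw [hx, Pi.smul_apply, Pi.smul_apply, smul_eq_mul, smul_eq_mul, mul_assoc])
    (fun c u v => by
      rw [← MemLp.toLp_add]
      refine MemLp.toLp_congr _ _ ?_
      filter_upwards [Lp.coeFn_add (fn u) (fn v)] with x hx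
      rw [← fnL_apply, map_add, fnL_apply, fnL_apply, hx, Pi.add_apply, Pi.add_apply, mul_add])
    (fun a c u => by
      rw [← MemLp.toLp_const_smul]
      refine MemLp.toLp_congr _ _ ?_
      filter_upwards [Lp.coeFn_smul a (fn u)] with x hx
      rw [← fnL_apply, map_smul, fnL_apply, hx, Pi.smul_apply, Pi.smul_apply, smul_eq_mul,
        smul_eq_mul, mul_left_comm])
  refine ⟨M.mkContinuous₂ C fun c u => ?_, fun c u => (hm c u).coeFn_toLp⟩
  rw [mul_right_comm]
  refine Lp.norm_le_mul_norm_of_ae_le_mul ?_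
  filter_upwards [(hm c u).coeFn_toLp, hbd c u] with x hx hx'
  rwa [LinearMap.mk₂_apply, hx]

/-- The weighted inner product of `H¹₀(0, L)`. -/
noncomputable def formH1 (L β : ℝ) : H10 L →L[ℝ] H10 L →L[ℝ] ℝ :=
  (innerSL ℝ).bilinearComp (fnL L) (fnL L) + (β / 6) • (innerSL ℝ).bilinearComp (dxL L) (dxL L)

theorem formH1_apply {L : ℝ} (β : ℝ) (u v : H10 L) :
    formH1 L β u v = inner ℝ (fn u) (fn v) + β / 6 * inner ℝ (dx u) (dx v) := rfl

theorem isCoercive_formH1 (L : ℝ) {β : ℝ} (hβ : 0 < β) : IsCoercive (formH1 L β) := by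
  refine ⟨min 1 (β / 6), by positivity, fun u => ?_⟩
  rw [formH1_apply, real_inner_self_eq_norm_sq, real_inner_self_eq_norm_sq, mul_assoc, ← sq,
    norm_sq_eq, mul_add]
  gcongr
  · exact mul_le_of_le_one_left (sq_nonneg _) (min_le_left _ _)
  · exact min_le_right _ _

/-- The operator `f ↦ -(1 - (β/6) ∂²)⁻¹ ∂ f`, in weak form. -/
theorem exists_resolvent {L β : ℝ} (hL : 0 < L) (hβ : 0 < β) :
    ∃ R : L2 L →L[ℝ] H10 L, ∀ f u, u = R f ↔ ∀ φ, formH1 L β u φ = inner ℝ f (dx φ) := by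
  have := completeSpace_H10 hL
  have hco := isCoercive_formH1 L hβ
  -- Lax–Milgram; the adjoint of `dxL` represents the functional `φ ↦ ⟨f, φ'⟩`.
  refine ⟨(hco.continuousLinearEquivOfBilin.symm : H10 L →L[ℝ] H10 L).comp
    (ContinuousLinearMap.adjoint (dxL L)), fun f u => ?_⟩
  rw [ContinuousLinearMap.comp_apply, ContinuousLinearEquiv.coe_coe,
    ContinuousLinearEquiv.eq_symm_apply]
  constructor
  · intro h φ
    rw [← hco.continuousLinearEquivOfBilin_apply, h, ContinuousLinearMap.adjoint_inner_left,
      dxL_apply]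
  · intro h
    refine (hco.unique_continuousLinearEquivOfBilin fun φ => ?_).symm
    rw [ContinuousLinearMap.adjoint_inner_left, h, dxL_apply]

theorem integral_mul_eq_inner {L : ℝ} (f g : L2 L) :
    ∫ x, f x * g x ∂(vol L) = inner ℝ f g := by
  rw [L2.inner_def]
  refine integral_congr_ae (Filter.Eventually.of_forall fun x => ?_)
  simp [mul_comm]

/-- The weak equations form a linear evolution equation in `H¹₀ × H¹₀`, whose generator depends
affinely and boundedly on the coefficient. -/
theorem exists_generator {L β : ℝ} (hL : 0 < L) (hβ : 0 < β) :
    ∃ (A : H10 L × H10 L →L[ℝ] H10 L × H10 L)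
      (B : L2 L →L[ℝ] (H10 L × H10 L) →L[ℝ] (H10 L × H10 L)),
      ∀ (T : ℝ) (N₀ V₀ : H10 L) (c : L2 L) (N V : ℝ → H10 L),
        IsSolution L β T N₀ V₀ c N V ↔
          SolvesLinear (A + B c) (N₀, V₀) T fun t => (N t, V t) := by
  obtain ⟨M, hM⟩ := exists_mul_clm hL
  obtain ⟨R, hR⟩ := exists_resolvent hL hβ
  let X := H10 L × H10 L
  let A : X →L[ℝ] X := (ContinuousLinearMap.inl ℝ (H10 L) (H10 L)).comp
    ((R.comp (fnL L)).comp (ContinuousLinearMap.snd ℝ (H10 L) (H10 L)))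
  let B : L2 L →L[ℝ] X →L[ℝ] X :=
    (ContinuousLinearMap.compL ℝ X (L2 L) X
      ((ContinuousLinearMap.inr ℝ (H10 L) (H10 L)).comp R)).comp
      (M.bilinearComp (ContinuousLinearMap.id ℝ (L2 L))
        (ContinuousLinearMap.fst ℝ (H10 L) (H10 L)))
  have hAB : ∀ c u v, (A + B c) (u, v) = (R (fn v), R (M c u)) := fun c u v => by
    change ((R (fn v), 0) : X) + (0, R (M c u)) = _
    rw [Prod.mk_add_mk, add_zero, zero_add]
  have hN : ∀ u v : H10 L, u = R (fn v) ↔ ∀ φ : H10 L,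
      (∫ x, fn u x * fn φ x ∂(vol L)) - (∫ x, fn v x * dx φ x ∂(vol L))
        + β / 6 * (∫ x, dx u x * dx φ x ∂(vol L)) = 0 := fun u v => by
    rw [hR]
    refine forall_congr' fun φ => ?_
    rw [integral_mul_eq_inner, integral_mul_eq_inner, integral_mul_eq_inner, formH1_apply,
      ← sub_eq_zero, sub_add_eq_add_sub]
  have hV : ∀ (c : L2 L) (u v : H10 L), v = R (M c u) ↔ ∀ ψ : H10 L,
      (∫ x, fn v x * fn ψ x ∂(vol L)) - (∫ x, c x * fn u x * dx ψ x ∂(vol L))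
        + β / 6 * (∫ x, dx v x * dx ψ x ∂(vol L)) = 0 := fun c u v => by
    rw [hR]
    refine forall_congr' fun ψ => ?_
    have e : ∫ x, c x * fn u x * dx ψ x ∂(vol L) = ∫ x, M c u x * dx ψ x ∂(vol L) := by
      refine integral_congr_ae ?_
      filter_upwards [hM c u] with x hx
      rw [hx]
    rw [e, integral_mul_eq_inner, integral_mul_eq_inner, integral_mul_eq_inner, formH1_apply,
      ← sub_eq_zero, sub_add_eq_add_sub]
  refine ⟨A, B, fun T N₀ V₀ c N V =>
    ⟨fun h => ⟨?_, fun t ht => ?_⟩, fun h => ⟨?_, ?_, fun t ht => ?_⟩⟩⟩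
  · exact Prod.ext h.initial_N h.initial_V
  · obtain ⟨Nt, Vt, h1, h2, h3, h4⟩ := h.equations t ht
    rw [hAB, ← (hN _ _).2 h3, ← (hV _ _ _).2 h4]
    exact h1.prodMk h2
  · exact congrArg Prod.fst h.1
  · exact congrArg Prod.snd h.1
  · have h1 := h.2 t ht
    rw [hAB] at h1
    refine ⟨_, _, ?_, ?_, (hN _ _).1 rfl, (hV _ _ _).1 rfl⟩
    · exact (ContinuousLinearMap.fst ℝ (H10 L) (H10 L)).hasFDerivAt.comp_hasDerivWithinAt t h1
    · exact (ContinuousLinearMap.snd ℝ (H10 L) (H10 L)).hasFDerivAt.comp_hasDerivWithinAt t h1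

/-! ### The weighted norm as a Hilbert norm -/

theorem normH1_sq {L β : ℝ} (hβ : 0 < β) (u : H10 L) :
    normH1 β u ^ 2 = ‖fn u‖ ^ 2 + β / 6 * ‖dx u‖ ^ 2 :=
  Real.sq_sqrt (by positivity)

theorem normH1H1_sq {L β : ℝ} (p : H10 L × H10 L) :
    normH1H1 β p ^ 2 = normH1 β p.1 ^ 2 + normH1 β p.2 ^ 2 :=
  Real.sq_sqrt (by positivity)

/-- `L² × L²` with the Hilbert space norm. -/
abbrev L2L2 (L : ℝ) : Type := WithLp 2 (L2 L × L2 L)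

/-- The weighted norm of `H¹₀ × H¹₀` is the pullback of a Hilbert space norm. -/
theorem exists_weighted_embedding (L : ℝ) {β : ℝ} (hβ : 0 < β) :
    ∃ Φ : H10 L × H10 L →L[ℝ] WithLp 2 (L2L2 L × L2L2 L), ∀ p, ‖Φ p‖ = normH1H1 β p := by
  -- The product type `H10 L × H10 L` carries the sup norm. Scaling `dx` by `√(β / 6)` and using
  -- `WithLp 2` targets produces the weighted norm.
  let ι : H10 L →L[ℝ] L2L2 L :=
    ((WithLp.prodContinuousLinearEquiv 2 ℝ (L2 L) (L2 L)).symm :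
      L2 L × L2 L →L[ℝ] L2L2 L).comp ((fnL L).prod (√(β / 6) • dxL L))
  have hι : ∀ u, ‖ι u‖ ^ 2 = normH1 β u ^ 2 := fun u => by
    rw [WithLp.prod_norm_sq_eq_of_L2, normH1_sq hβ]
    change ‖fn u‖ ^ 2 + ‖√(β / 6) • dx u‖ ^ 2 = _
    rw [norm_smul, mul_pow, Real.norm_eq_abs, sq_abs, Real.sq_sqrt (by positivity)]
  refine ⟨((WithLp.prodContinuousLinearEquiv 2 ℝ (L2L2 L) (L2L2 L)).symm :
      L2L2 L × L2L2 L →L[ℝ] WithLp 2 (L2L2 L × L2L2 L)).comp (ι.prodMap ι), fun p => ?_⟩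
  have h0 : 0 ≤ normH1H1 β p := Real.sqrt_nonneg _
  rw [← sq_eq_sq₀ (norm_nonneg _) h0, WithLp.prod_norm_sq_eq_of_L2, normH1H1_sq,
    ← hι, ← hι]
  rfl

end BoussinesqRMP

/-! ### Transfer to the minimization problem -/

theorem theorem3 (L β α γ : ℝ) (hL : 0 < L) (hβ : 0 < β) (hα : 0 < α) (hγ : 0 ≤ γ)
    (N₀ V₀ : H10 L) (ρ : ℝ) :
    ∃ T₀ > 0, ∃ S > 0, ∀ T : ℝ, 0 < T → T ≤ T₀ →
      ∀ m m' : H10 L × H10 L, normH1H1 β m ≤ ρ → normH1H1 β m' ≤ ρ →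
        ∀ c c' : L2 L, IsOptimal L β α γ T N₀ V₀ m c → IsOptimal L β α γ T N₀ V₀ m' c' →
          ‖c' - c‖ ≤ S * normH1H1 β (m' - m) := by
  have := completeSpace_H10 hL
  obtain ⟨A, B, hAB⟩ := exists_generator hL hβ
  obtain ⟨Φ, hΦ⟩ := exists_weighted_embedding L hβ
  obtain ⟨T₀, hT₀, S, hS, h⟩ :=
    exists_stability_of_bilinear_ode A B Φ (N₀, V₀) hα hγ ρ
  have hJ : ∀ (m : H10 L × H10 L) (c : L2 L) (u : H10 L × H10 L),
      1 / 2 * ‖Φ u - Φ m‖ ^ 2 + α / 2 * ‖c‖ ^ 2 = tikhonov β α m c u.1 u.2 := fun m c u => by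
    rw [← map_sub, hΦ, normH1H1_sq, tikhonov, Prod.fst_sub, Prod.snd_sub]
    ring
  have hopt : ∀ (T : ℝ) (m : H10 L × H10 L) (c : L2 L), IsOptimal L β α γ T N₀ V₀ m c →
      ‖c‖ ≤ γ ∧ ∃ U, SolvesLinear (A + B c) (N₀, V₀) T U ∧
        ∀ d : L2 L, ‖d‖ ≤ γ → ∀ W, SolvesLinear (A + B d) (N₀, V₀) T W →
          1 / 2 * ‖Φ (U T) - Φ m‖ ^ 2 + α / 2 * ‖c‖ ^ 2
            ≤ 1 / 2 * ‖Φ (W T) - Φ m‖ ^ 2 + α / 2 * ‖d‖ ^ 2 := by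
    rintro T m c ⟨hcγ, N, V, hsol, hmin⟩
    refine ⟨hcγ, fun t => (N t, V t), (hAB _ _ _ _ _ _).1 hsol, fun d hd W hW => ?_⟩
    rw [hJ, hJ]
    -- The converse half of `hAB` turns any abstract trajectory into an admissible competitor.
    exact hmin d hd (fun t => (W t).1) (fun t => (W t).2) ((hAB T N₀ V₀ d _ _).2 hW)
  refine ⟨T₀, hT₀, S, hS, fun T hT hTT m m' hm _ c c' hc hc' => ?_⟩
  obtain ⟨hcγ, U, hU, hmin⟩ := hopt T m c hc
  obtain ⟨hcγ', U', hU', hmin'⟩ := hopt T m' c' hc'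
  rw [← hΦ, map_sub]
  exact h T hT hTT (Φ m) (Φ m') ((hΦ m).trans_le hm) c c' hcγ hcγ' U U' hU hU' hmin hmin'
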